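/- Let $\mathcal A$ be a Boolean algebra. A function $\phi:\mathcal A\to\mathbb R$ is a *submeasure* if $\phi(0)=0$, $\phi(A)\le\phi(B)$ whenever $A\le B$, and $\phi(A\vee B)\le\phi(A)+\phi(B)$ for all $A,B\in\mathcal A$. It is *diffuse* if for every $\epsilon>0$ there is a finite $\mathcal B\subseteq\mathcal A$ with $\bigvee\mathcal B=1$ and $\phi(B)\le\epsilon$ for all $B\in\mathcal B$. For a finite set $\mathcal F\subseteq\mathcal A$ let $\langle\mathcal F\rangle$ be the set of nonzero elements of the form $\bigwedge\mathcal F_0\wedge\bigwedge_{B\in\mathcal F\setminus\mathcal F_0}\neg B$ with $\mathcal F_0\subseteq\mathcal F$. For a finite sequence $\mathcal C=(C_i)_{i<m}$ in $\mathcal A$, $m\ge1$, put $$t(\mathcal C)=\sup\{k\in\mathbb N : |\{i<m : B\le C_i\}|\ge k\ \text{ for all } B\in\langle\{C_i: i<m\}\rangle\}.$$ For a diffuse submeasure $\phi$ and $\xi>0$ let $$h_\phi(\xi)=\frac1\xi\,\sup\Bigl\{\frac{t(\mathcal C)}{m} : m\ge 1,\ \mathcal C=(C_i)_{i<m}\in\mathcal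 A^m,\ \phi(C_i)\le\xi \text{ for all } i<m\Bigr\}.$$ (If $\mathcal A$ is the zero algebra, then $t(\mathcal C)=h_\phi(\xi)=\infty$ and $1/\infty=0$.) The diffuse submeasure $\phi$ is *elliptic* if $h_\phi(\xi)=O(\xi)$ as $\xi\to0$, i.e. $\limsup_{\xi\to0^+}h_\phi(\xi)/\xi<\infty$; it is *hyperbolic* if $1/h_\phi(\xi)=O(\xi)$ as $\xi\to0$, i.e. $\limsup_{\xi\to0^+}\frac{1}{\xi h_\phi(\xi)}<\infty$; and it is *parabolic* if it is neither elliptic nor hyperbolic. Let $\Pi(\mathcal A)$ be the set of finite partitions of unity in $\mathcal A$, i.e. finite sets of nonzero, pairwise disjoint elements with join $1$, and write $\mathcal C\preceq\mathcal B$ if every $B\in\mathcal B$ lies below some $C\in\mathcal C$. For $\mathcal B\in\Pi(\mathcal A)$ equip $[0,1]^{\mathcal B}$ with the pseudo-metric $$\delta_{\phi,\mathcal B}(x,y)=\phi\Bigl(\bigvee\{B\in\mathcal B : x(B)\ne y(B)\}\Bigr)$$ and the product $\lambda^{\otimes\mathcal B}$ of the Lebesgue measure $\lambda$ on $[0,1]$,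 and for $\epsilon>0$ let $$\alpha_{\phi,\mathcal B}(\epsilon)=1-\inf\bigl\{\lambda^{\otimes\mathcal B}(\{x : \exists a\in S,\ \delta_{\phi,\mathcal B}(a,x)<\epsilon\}) : S\subseteq[0,1]^{\mathcal B}\text{ Borel},\ \lambda^{\otimes\mathcal B}(S)\ge\tfrac12\bigr\}$$ be the concentration function of this metric measure space (the measure being completed). **Theorem.** Every hyperbolic or parabolic diffuse submeasure $\phi$ on a Boolean algebra $\mathcal A$ has *covering concentration*: for every $\epsilon>0$ there exists $\mathcal C\in\Pi(\mathcal A)$ such that $$\sup\{\alpha_{\phi,\mathcal B}(\epsilon) : \mathcal B\in\Pi(\mathcal A),\ \mathcal C\preceq\mathcal B\}\le\epsilon.$$ -/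

import Mathlib

open MeasureTheory Filter Topology Set
open scoped ENNReal

noncomputable section

/-! ## Metric measure spaces and their concentration function -/

/-- The open `ε`-neighbourhood `{x | ∃ a ∈ S, d a x < ε}` of `S` for the pseudo-metric `d`. -/
def nbhd {X : Type*} (d : X → X → ℝ) (S : Set X) (ε : ℝ) : Set X :=
  {x | ∃ a ∈ S, d a x < ε}

/-- The concentration function of the metric measure space `(X, d, μ)`,
`ε ↦ 1 - inf {μ (nbhd d S ε) | S measurable, μ S ≥ 1/2}`.
The neighbourhood of a measurable set is `μ`-measurable on a standard Borel space with measurable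
pseudo-metric, so Mathlib's (outer) measure gives its measure for the completion of `μ`. -/
def concentrationFunction {X : Type*} [MeasurableSpace X] (d : X → X → ℝ) (μ : Measure X)
    (ε : ℝ) : ℝ≥0∞ :=
  1 - ⨅ (S : Set X) (_ : MeasurableSet S) (_ : 1 / 2 ≤ μ S), μ (nbhd d S ε)

/-! ## Covering numbers in Boolean algebras -/

section Covering

variable {A : Type*} [BooleanAlgebra A]

open Classical in
/-- The finite partition of unity generated by a finite set `F`: the nonzero elements of the form
`(⋀ F₀) ∧ ⋀_{b ∈ F \ F₀} ¬ b` with `F₀ ⊆ F`. -/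
def generatedPartition (F : Finset A) : Set A :=
  {a | ∃ F₀ ⊆ F, a = F₀.inf id ⊓ (F \ F₀).inf (fun b => bᶜ)} \ {⊥}

open Classical in
/-- The covering multiplicity `t_A(C)` of a finite sequence `C`: the supremum of all `k ∈ ℕ` such
that every member of the partition generated by `C` lies below at least `k` of the terms `C i`.
(It is `⊤` only if `A` is the zero algebra.) -/
def coveringMultiplicity {m : ℕ} (C : Fin m → A) : ℕ∞ :=
  ⨆ (k : ℕ) (_ : ∀ b ∈ generatedPartition (Finset.univ.image C),
    k ≤ (Finset.univ.filter (fun i => b ≤ C i)).card), (k : ℕ∞)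

/-- Kelley's covering number `c_A(𝓑)` of a subset `𝓑` of `A`: the supremum of the ratios `t_A(C)/n`
over `n ≥ 1` and all sequences `C` of length `n` in `𝓑`. -/
def coveringNumber (𝓑 : Set A) : ℝ≥0∞ :=
  ⨆ (n : ℕ) (_ : 1 ≤ n) (C : Fin n → A) (_ : ∀ i, C i ∈ 𝓑),
    ((coveringMultiplicity C : ℕ∞) : ℝ≥0∞) / (n : ℝ≥0∞)

/-! ## Submeasures and their classification -/

/-- Submeasures on a Boolean algebra. -/
structure IsSubmeasure (φ : A → ℝ) : Prop where
  map_bot : φ ⊥ = 0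
  mono : ∀ a b : A, a ≤ b → φ a ≤ φ b
  subadd : ∀ a b : A, φ (a ⊔ b) ≤ φ a + φ b

/-- Diffuse: for each `ε > 0` the unit is a finite join of elements of `φ`-value at most `ε`. -/
def IsDiffuse (φ : A → ℝ) : Prop :=
  ∀ ε : ℝ, 0 < ε → ∃ F : Finset A, F.sup id = ⊤ ∧ ∀ b ∈ F, φ b ≤ ε

/-- The function `h_φ(ξ) = c_A({a | φ a ≤ ξ}) / ξ`, for `ξ > 0`. -/
def hFun (φ : A → ℝ) (ξ : ℝ) : ℝ≥0∞ :=
  coveringNumber {a : A | φ a ≤ ξ} / ENNReal.ofReal ξ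

/-- `f(ξ) = O(g(ξ))` as `ξ → 0`, for functions on the positive reals:
`limsup_{ξ → 0+} f(ξ)/g(ξ) < ∞`. -/
def IsBigOAtZero (f g : ℝ → ℝ≥0∞) : Prop :=
  limsup (fun ξ : ℝ => f ξ / g ξ) (𝓝[>] (0 : ℝ)) < ⊤

/-- A diffuse submeasure is elliptic if `h_φ(ξ) = O(ξ)` as `ξ → 0`. -/
def IsElliptic (φ : A → ℝ) : Prop :=
  IsSubmeasure φ ∧ IsDiffuse φ ∧ IsBigOAtZero (hFun φ) ENNReal.ofReal

/-- A diffuse submeasure is hyperbolic if `1 / h_φ(ξ) = O(ξ)` as `ξ → 0`. -/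
def IsHyperbolic (φ : A → ℝ) : Prop :=
  IsSubmeasure φ ∧ IsDiffuse φ ∧ IsBigOAtZero (fun ξ => 1 / hFun φ ξ) ENNReal.ofReal

/-- A diffuse submeasure is parabolic if it is neither elliptic nor hyperbolic. -/
def IsParabolic (φ : A → ℝ) : Prop :=
  IsSubmeasure φ ∧ IsDiffuse φ ∧ ¬ IsElliptic φ ∧ ¬ IsHyperbolic φ

/-! ## Covering concentration

Finite partitions of unity in `A` are the elements of `Finpartition (⊤ : A)`: finite sets of nonzero,
pairwise disjoint elements with join `⊤`. In Mathlib's order, `B ≤ C` says that `B` refines `C`, i.e.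
that each `b ∈ B` lies below some `c ∈ C`. -/

open Classical in
/-- The pseudo-metric `δ_{φ,B}(x, y) = φ (⋁ {b ∈ B | x b ≠ y b})` on `Ω^B`. -/
def submeasureDist (φ : A → ℝ) (B : Finpartition (⊤ : A)) {Ω : Type*} (x y : B.parts → Ω) : ℝ :=
  φ ((Finset.univ.filter (fun b : B.parts => x b ≠ y b)).sup (fun b => (b : A)))

/-- The submeasure `φ` has covering concentration: for every `ε > 0` there is a finite partition of
unity `C` such that the supremum of the concentration functions at `ε` of the metric measure spaces
`([0,1]^B, δ_{φ,B}, λ^{⊗B})`, over all finite partitions of unity `B` refining `C`, is at most `ε`. -/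
def HasCoveringConcentration (φ : A → ℝ) : Prop :=
  ∀ ε : ℝ, 0 < ε → ∃ C : Finpartition (⊤ : A),
    (⨆ (B : Finpartition (⊤ : A)) (_ : B ≤ C),
      concentrationFunction (submeasureDist φ B (Ω := unitInterval))
        (Measure.pi (fun _ : B.parts => (volume : Measure unitInterval))) ε) ≤ ENNReal.ofReal ε

end Covering

end

/-!
For a hyperbolic or parabolic submeasure `h_φ(ξ) / ξ` is unbounded as `ξ → 0`
(`exists_lt_hFun_div`). Unfolding the covering number, there are elements `C 0, …, C (m - 1)` with
`φ (C i) ≤ ξ` such that every part of some finite partition of unity `P` lies below at least `k`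
of them, and `m * ξ ^ 2 / k` is arbitrarily small (`exists_cover_of_lt_coveringNumber`).

Let `B` refine `P`. Then the sets `{b ∈ B | b ≤ C i}` cover each coordinate of `[0,1]^B` at least
`k` times, and changing the coordinates in one of them moves a point by at most `ξ`. The
Efron–Stein inequality for covers (`mul_variance_le_of_cover`) therefore bounds the variance of
any function `f` that is `1`-Lipschitz for `δ_{φ,B}` by `m * ξ ^ 2 / k`. It says that
`k * Var f ≤ ∑ i, 𝔼 (Var_{C i} f)`, where `Var_s` is the variance in the coordinates in `s`; this is
Shearer's inequality (`mul_le_sum_of_submodular`) for the set function `s ↦ 𝔼 (Var_s f)`, which is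
submodular because the averaging operators are commuting orthogonal projections
(`integral_coordAvg_sq_submodular`).

Given `S` of measure at least `1 / 2`, take for `f` the distance to a compact subset of `S` of
measure more than `1 / 4`. Chebyshev's inequality, used on both tails
(`measureReal_le_of_integral_sq_le`), bounds the measure of `{f ≥ ε}`. As covering concentration
only asks for some small bound, the variance suffices, and no exponential moments of `f` are needed.
-/

/-! ### Averaging over a set of coordinates -/

section CoordAvg

variable {ι : Type*} [Fintype ι] [DecidableEq ι] {Ω : ι → Type*} [∀ i, MeasurableSpace (Ω i)]

/-- The average of `f` over the coordinates in `s`, which are resampled independently according to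
`ν`, the others being kept: the conditional expectation of `f` given the coordinates outside `s`.
All coordinates of `y` are integrated, so that the averages over different sets are defined on the
same space; this is harmless for probability measures. -/
noncomputable def coordAvg (ν : ∀ i, Measure (Ω i)) (s : Finset ι) (f : (∀ i, Ω i) → ℝ)
    (x : ∀ i, Ω i) : ℝ :=
  ∫ y, f (s.piecewise y x) ∂Measure.pi ν

/-- Bounded measurable functions, a class stable under `coordAvg` on which no integrability issue
arises. -/
def IsBddMeasurable {X : Type*} [MeasurableSpace X] (f : X → ℝ) : Prop :=
  Measurable f ∧ ∃ M : ℝ, ∀ x, |f x| ≤ M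

theorem IsBddMeasurable.integrable {X : Type*} [MeasurableSpace X] {μ : Measure X}
    [IsFiniteMeasure μ] {f : X → ℝ} (hf : IsBddMeasurable f) : Integrable f μ := by
  obtain ⟨hm, M, hM⟩ := hf
  exact Integrable.of_bound hm.aestronglyMeasurable M (ae_of_all _ hM)

theorem IsBddMeasurable.comp {X Y : Type*} [MeasurableSpace X] [MeasurableSpace Y] {f : Y → ℝ}
    (hf : IsBddMeasurable f) {g : X → Y} (hg : Measurable g) :
    IsBddMeasurable (fun x => f (g x)) :=
  ⟨hf.1.comp hg, hf.2.imp fun _ hM x => hM (g x)⟩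

theorem IsBddMeasurable.sub {X : Type*} [MeasurableSpace X] {f g : X → ℝ}
    (hf : IsBddMeasurable f) (hg : IsBddMeasurable g) : IsBddMeasurable (fun x => f x - g x) := by
  obtain ⟨hf, M, hM⟩ := hf
  obtain ⟨hg, N, hN⟩ := hg
  exact ⟨hf.sub hg, M + N, fun x => (abs_sub _ _).trans (add_le_add (hM x) (hN x))⟩

theorem IsBddMeasurable.mul {X : Type*} [MeasurableSpace X] {f g : X → ℝ}
    (hf : IsBddMeasurable f) (hg : IsBddMeasurable g) : IsBddMeasurable (fun x => f x * g x) := by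
  obtain ⟨hf, M, hM⟩ := hf
  obtain ⟨hg, N, hN⟩ := hg
  refine ⟨hf.mul hg, M * N, fun x => ?_⟩
  rw [abs_mul]
  exact mul_le_mul (hM x) (hN x) (abs_nonneg _) ((abs_nonneg _).trans (hM x))

omit [Fintype ι] in
theorem measurable_finset_piecewise (s : Finset ι) :
    Measurable fun p : (∀ i, Ω i) × (∀ i, Ω i) => s.piecewise p.2 p.1 := by
  refine measurable_pi_lambda _ fun i => ?_
  by_cases hi : i ∈ s
  · simp only [Finset.piecewise_eq_of_mem _ _ _ hi]; fun_prop
  · simp only [Finset.piecewise_eq_of_notMem _ _ _ hi]; fun_prop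

variable (ν : ∀ i, Measure (Ω i)) [∀ i, IsProbabilityMeasure (ν i)]

/-- Replacing the coordinates in `s` of a random point by those of an independent copy does not
change its distribution. -/
theorem measurePreserving_finset_piecewise (s : Finset ι) :
    MeasurePreserving (fun p : (∀ i, Ω i) × (∀ i, Ω i) => s.piecewise p.2 p.1)
      ((Measure.pi ν).prod (Measure.pi ν)) (Measure.pi ν) := by
  refine ⟨measurable_finset_piecewise s, (Measure.pi_eq fun t ht => ?_).symm⟩
  rw [Measure.map_apply (measurable_finset_piecewise s) (MeasurableSet.univ_pi ht)]
  have h : (fun p : (∀ i, Ω i) × (∀ i, Ω i) => s.piecewise p.2 p.1) ⁻¹' univ.pi t =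
      (univ.pi fun i => if i ∈ s then univ else t i) ×ˢ
        (univ.pi fun i => if i ∈ s then t i else univ) := by
    ext p
    simp only [mem_preimage, mem_univ_pi, mem_prod, ← forall_and]
    refine forall_congr' fun i => ?_
    by_cases hi : i ∈ s <;> simp [hi]
  rw [h, Measure.prod_prod, Measure.pi_pi, Measure.pi_pi, ← Finset.prod_mul_distrib]
  refine Finset.prod_congr rfl fun i _ => ?_
  by_cases hi : i ∈ s <;> simp [hi]

variable {ν}

theorem integral_coordAvg (s : Finset ι) {f : (∀ i, Ω i) → ℝ} (hf : IsBddMeasurable f) :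
    ∫ x, coordAvg ν s f x ∂Measure.pi ν = ∫ x, f x ∂Measure.pi ν := by
  have h := measurePreserving_finset_piecewise ν s
  rw [← h.map_eq, integral_map h.measurable.aemeasurable hf.1.aestronglyMeasurable, h.map_eq,
    integral_prod _ (hf.comp h.measurable).integrable]
  rfl

theorem IsBddMeasurable.coordAvg (s : Finset ι) {f : (∀ i, Ω i) → ℝ} (hf : IsBddMeasurable f) :
    IsBddMeasurable (coordAvg ν s f) := by
  constructor
  · have h := (hf.1.comp (measurable_finset_piecewise s)).stronglyMeasurable
    exact (h.integral_prod_right' (ν := Measure.pi ν)).measurable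
  · obtain ⟨M, hM⟩ := hf.2
    refine ⟨M, fun x => ?_⟩
    have := norm_integral_le_of_norm_le_const (μ := Measure.pi ν)
      (f := fun y => f (s.piecewise y x)) (ae_of_all _ fun y => hM _)
    simpa [_root_.coordAvg] using this

omit [∀ i, IsProbabilityMeasure (ν i)] in
theorem coordAvg_piecewise (s : Finset ι) (f : (∀ i, Ω i) → ℝ) (x y : ∀ i, Ω i) :
    coordAvg ν s f (s.piecewise y x) = coordAvg ν s f x := by
  simp [coordAvg]

theorem coordAvg_coordAvg (s t : Finset ι) {f : (∀ i, Ω i) → ℝ} (hf : IsBddMeasurable f) :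
    coordAvg ν s (coordAvg ν t f) = coordAvg ν (s ∪ t) f := by
  funext x
  have hpw (y z : ∀ i, Ω i) :
      t.piecewise z (s.piecewise y x) = (s ∪ t).piecewise (t.piecewise z y) x := by
    funext i
    by_cases ht : i ∈ t <;> by_cases hs : i ∈ s <;> simp [Finset.piecewise, hs, ht]
  have hg : IsBddMeasurable fun w => f ((s ∪ t).piecewise w x) :=
    hf.comp ((measurable_finset_piecewise (s ∪ t)).comp (by fun_prop : Measurable fun w => (x, w)))
  calc coordAvg ν s (coordAvg ν t f) x
      = ∫ y, coordAvg ν t (fun w => f ((s ∪ t).piecewise w x)) y ∂Measure.pi ν := by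
        simp only [coordAvg, hpw]
    _ = _ := integral_coordAvg t hg

theorem coordAvg_sub (s : Finset ι) {f g : (∀ i, Ω i) → ℝ} (hf : IsBddMeasurable f)
    (hg : IsBddMeasurable g) :
    coordAvg ν s (fun x => f x - g x) = fun x => coordAvg ν s f x - coordAvg ν s g x := by
  funext x
  have hm : Measurable fun w : ∀ i, Ω i => s.piecewise w x :=
    (measurable_finset_piecewise s).comp (by fun_prop : Measurable fun w => (x, w))
  exact integral_sub (hf.comp hm).integrable (hg.comp hm).integrable

/-- `coordAvg ν s` is an orthogonal projection: `⟪f, E f⟫ = ‖E f‖²`. -/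
theorem integral_mul_coordAvg (s : Finset ι) {f : (∀ i, Ω i) → ℝ} (hf : IsBddMeasurable f) :
    ∫ x, f x * coordAvg ν s f x ∂Measure.pi ν = ∫ x, coordAvg ν s f x ^ 2 ∂Measure.pi ν := by
  rw [← integral_coordAvg s (hf.mul (hf.coordAvg s))]
  congr 1
  funext x
  rw [coordAvg]
  simp only [coordAvg_piecewise, integral_mul_const]
  rw [sq]
  rfl

theorem integral_sub_coordAvg_sq (s : Finset ι) {f : (∀ i, Ω i) → ℝ} (hf : IsBddMeasurable f) :
    ∫ x, (f x - coordAvg ν s f x) ^ 2 ∂Measure.pi ν =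
      ∫ x, f x ^ 2 ∂Measure.pi ν - ∫ x, coordAvg ν s f x ^ 2 ∂Measure.pi ν := by
  have hE := hf.coordAvg (ν := ν) s
  have h1 : Integrable (fun x => f x ^ 2) (Measure.pi ν) := by
    simpa only [sq] using (hf.mul hf).integrable
  have h2 : Integrable (fun x => coordAvg ν s f x ^ 2) (Measure.pi ν) := by
    simpa only [sq] using (hE.mul hE).integrable
  have h3 : Integrable (fun x => f x * coordAvg ν s f x) (Measure.pi ν) := (hf.mul hE).integrable
  have h4 : (fun x => (f x - coordAvg ν s f x) ^ 2) =
      fun x => f x ^ 2 - 2 * (f x * coordAvg ν s f x) + coordAvg ν s f x ^ 2 := by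
    funext x; ring
  have h5 := h1.sub (h3.const_mul 2)
  simp only [Pi.sub_def] at h5
  rw [h4, integral_add h5 h2, integral_sub h1 (h3.const_mul 2),
    integral_const_mul, integral_mul_coordAvg s hf]
  ring

theorem integral_coordAvg_sq_le (s : Finset ι) {f : (∀ i, Ω i) → ℝ} (hf : IsBddMeasurable f) :
    ∫ x, coordAvg ν s f x ^ 2 ∂Measure.pi ν ≤ ∫ x, f x ^ 2 ∂Measure.pi ν := by
  have h := integral_sub_coordAvg_sq (ν := ν) s hf
  have h0 : 0 ≤ ∫ x, (f x - coordAvg ν s f x) ^ 2 ∂Measure.pi ν :=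
    integral_nonneg fun x => sq_nonneg _
  linarith

/-- The decrease of `‖E_s f‖²` caused by averaging over one more set `u` of coordinates is itself
decreasing in `s`: it equals `‖E_s f - E_{s ∪ u} f‖²`, and `E_t` is a contraction that maps
`E_s f - E_{s ∪ u} f` to `E_t f - E_{t ∪ u} f` when `s ⊆ t`. -/
theorem integral_coordAvg_sq_submodular {s t : Finset ι} (hst : s ⊆ t) (u : Finset ι)
    {f : (∀ i, Ω i) → ℝ} (hf : IsBddMeasurable f) :
    ∫ x, coordAvg ν t f x ^ 2 ∂Measure.pi ν - ∫ x, coordAvg ν (u ∪ t) f x ^ 2 ∂Measure.pi ν ≤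
      ∫ x, coordAvg ν s f x ^ 2 ∂Measure.pi ν - ∫ x, coordAvg ν (u ∪ s) f x ^ 2 ∂Measure.pi ν := by
  have key (r : Finset ι) := integral_sub_coordAvg_sq (ν := ν) u (hf.coordAvg (ν := ν) r)
  simp only [coordAvg_coordAvg _ _ hf] at key
  rw [← key t, ← key s]
  have h := integral_coordAvg_sq_le (ν := ν) t
    ((hf.coordAvg (ν := ν) s).sub (hf.coordAvg (ν := ν) (u ∪ s)))
  rw [coordAvg_sub t (hf.coordAvg s) (hf.coordAvg _), coordAvg_coordAvg _ _ hf,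
    coordAvg_coordAvg _ _ hf, Finset.union_eq_left.2 hst, Finset.union_left_comm,
    Finset.union_eq_left.2 hst] at h
  exact h

end CoordAvg

/-! ### The Efron–Stein inequality for covers -/

/-- Shearer's inequality for monotone submodular set functions: if each point lies in at least `k`
of the sets `C i`, then `k * g univ ≤ ∑ i, g (C i)`. -/
theorem mul_le_sum_of_submodular {ι κ : Type*} [Fintype ι] [DecidableEq ι] [Fintype κ]
    {g : Finset ι → ℝ} (h_empty : g ∅ = 0) (h_mono : ∀ s j, g s ≤ g (insert j s))
    (h_sub : ∀ s t j, s ⊆ t → g (insert j t) - g t ≤ g (insert j s) - g s)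
    (C : κ → Finset ι) (k : ℕ) (hC : ∀ j, k ≤ (Finset.univ.filter fun i => j ∈ C i).card) :
    k * g Finset.univ ≤ ∑ i, g (C i) := by
  suffices h : ∀ s : Finset ι, k * g s ≤ ∑ i, g (C i ∩ s) by simpa using h Finset.univ
  intro s
  induction s using Finset.induction_on with
  | empty => simp [h_empty]
  | insert j s hj ih =>
    have hd : 0 ≤ g (insert j s) - g s := sub_nonneg.2 (h_mono s j)
    have h1 (i : κ) : (if j ∈ C i then g (insert j s) - g s else 0) ≤
        g (C i ∩ insert j s) - g (C i ∩ s) := by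
      split_ifs with hi
      · rw [Finset.inter_insert_of_mem hi]
        exact h_sub _ _ _ Finset.inter_subset_right
      · rw [Finset.inter_insert_of_notMem hi, sub_self]
    have h2 := Finset.sum_le_sum fun i (_ : i ∈ Finset.univ) => h1 i
    rw [← Finset.sum_filter, Finset.sum_const, nsmul_eq_mul, Finset.sum_sub_distrib] at h2
    have h3 := mul_le_mul_of_nonneg_right (Nat.cast_le (α := ℝ).2 (hC j)) hd
    linarith

/-- The Efron–Stein inequality for covers: if each coordinate lies in at least `k` of the `m` sets
`C i`, and changing the coordinates in a single `C i` changes `f` by at most `r`, then the variance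
of `f` is at most `m * r ^ 2 / k`. -/
theorem mul_variance_le_of_cover {ι : Type*} [Fintype ι] [DecidableEq ι] {Ω : ι → Type*}
    [∀ i, MeasurableSpace (Ω i)] (ν : ∀ i, Measure (Ω i)) [∀ i, IsProbabilityMeasure (ν i)]
    {f : (∀ i, Ω i) → ℝ} (hf : IsBddMeasurable f) {m : ℕ} (C : Fin m → Finset ι) (k : ℕ)
    (hC : ∀ j, k ≤ (Finset.univ.filter fun i => j ∈ C i).card) {r : ℝ}
    (hr : ∀ i x y, |f x - f ((C i).piecewise y x)| ≤ r) :
    k * ∫ x, (f x - ∫ y, f y ∂Measure.pi ν) ^ 2 ∂Measure.pi ν ≤ m * r ^ 2 := by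
  have hu (s : Finset ι) (j : ι) : insert j s = {j} ∪ s := rfl
  have h := mul_le_sum_of_submodular
    (g := fun s => ∫ x, (f x - coordAvg ν s f x) ^ 2 ∂Measure.pi ν)
    (by simp [coordAvg]) ?_ ?_ C k hC
  · have huniv : coordAvg ν Finset.univ f = fun _ => ∫ y, f y ∂Measure.pi ν := by
      funext x; simp [coordAvg]
    simp only [huniv] at h
    refine h.trans ?_
    have hi (i : Fin m) : ∫ x, (f x - coordAvg ν (C i) f x) ^ 2 ∂Measure.pi ν ≤ r ^ 2 := by
      have hd := hf.sub (hf.coordAvg (ν := ν) (C i))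
      have hle := integral_mono (μ := Measure.pi ν) (hd.mul hd).integrable
        (integrable_const (r ^ 2)) fun x => ?_
      · simpa [sq] using hle
      have hm : Measurable fun w : ∀ i, Ω i => (C i).piecewise w x :=
        (measurable_finset_piecewise (C i)).comp (by fun_prop : Measurable fun w => (x, w))
      have hx : |f x - coordAvg ν (C i) f x| ≤ r := by
        have h1 : f x - coordAvg ν (C i) f x =
            ∫ y, (f x - f ((C i).piecewise y x)) ∂Measure.pi ν := by
          rw [integral_sub (integrable_const _) (hf.comp hm).integrable]
          simp [coordAvg]
        rw [h1]
        simpa using norm_integral_le_of_norm_le_const (μ := Measure.pi ν)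
          (f := fun y => f x - f ((C i).piecewise y x)) (ae_of_all _ fun y => hr i x y)
      have := sq_le_sq' (abs_le.1 hx).1 (abs_le.1 hx).2
      simpa only [sq] using this
    calc _ ≤ ∑ _i : Fin m, r ^ 2 := Finset.sum_le_sum fun i _ => hi i
      _ = m * r ^ 2 := by simp
  · intro s j
    have h0 := integral_coordAvg_sq_le (ν := ν) {j} (hf.coordAvg (ν := ν) s)
    rw [coordAvg_coordAvg _ _ hf] at h0
    simp only [integral_sub_coordAvg_sq _ hf, hu]
    linarith
  · intro s t j hst
    have h0 := integral_coordAvg_sq_submodular (ν := ν) hst {j} hf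
    simp only [integral_sub_coordAvg_sq _ hf, hu]
    linarith

/-! ### Concentration of the distance to a compact set -/

section Distance

variable {A : Type*} [BooleanAlgebra A] {φ : A → ℝ}

theorem IsSubmeasure.nonneg (hφ : IsSubmeasure φ) (a : A) : 0 ≤ φ a :=
  hφ.map_bot ▸ hφ.mono ⊥ a bot_le

variable {B : Finpartition (⊤ : A)} {Ω : Type*}

theorem submeasureDist_nonneg (hφ : IsSubmeasure φ) (x y : B.parts → Ω) :
    0 ≤ submeasureDist φ B x y :=
  hφ.nonneg _

theorem submeasureDist_le_top (hφ : IsSubmeasure φ) (x y : B.parts → Ω) :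
    submeasureDist φ B x y ≤ φ ⊤ :=
  hφ.mono _ _ le_top

theorem submeasureDist_self (hφ : IsSubmeasure φ) (x : B.parts → Ω) :
    submeasureDist φ B x x = 0 := by
  simp [submeasureDist, hφ.map_bot]

/-- Points that agree outside a set of parts lying below `c` are at distance at most `φ c`. -/
theorem submeasureDist_le_of_forall_eq (hφ : IsSubmeasure φ) {x y : B.parts → Ω} {c : A}
    (h : ∀ b : B.parts, ¬ (b : A) ≤ c → x b = y b) : submeasureDist φ B x y ≤ φ c := by
  classical
  refine hφ.mono _ _ (Finset.sup_le fun b hb => ?_)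
  by_contra hbc
  exact (Finset.mem_filter.1 hb).2 (h b hbc)

theorem submeasureDist_triangle (hφ : IsSubmeasure φ) (x y z : B.parts → Ω) :
    submeasureDist φ B x z ≤ submeasureDist φ B x y + submeasureDist φ B y z := by
  classical
  refine le_trans (hφ.mono _ _ (Finset.sup_le fun b hb => ?_)) (hφ.subadd _ _)
  have hxz := (Finset.mem_filter.1 hb).2
  by_cases hxy : x b = y b
  · exact le_sup_of_le_right (Finset.le_sup (f := fun b : B.parts => (b : A))
      (Finset.mem_filter.2 ⟨Finset.mem_univ b, hxy ▸ hxz⟩))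
  · exact le_sup_of_le_left (Finset.le_sup (f := fun b : B.parts => (b : A))
      (Finset.mem_filter.2 ⟨Finset.mem_univ b, hxy⟩))

/-- The neighbourhood of `K` is the union, over the sets `T` of coordinates of small `φ`-value, of
the cylinders over the projections of `K` to the coordinates outside `T`. -/
theorem isClosed_nbhd_submeasureDist [TopologicalSpace Ω] [T2Space Ω] (hφ : IsSubmeasure φ)
    {K : Set (B.parts → Ω)} (hK : IsCompact K) (r : ℝ) :
    IsClosed (nbhd (submeasureDist φ B) K r) := by
  classical
  have h : nbhd (submeasureDist φ B) K r =
      ⋃ T ∈ {T : Finset B.parts | φ (T.sup fun b => (b : A)) < r},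
        (fun (x : B.parts → Ω) (b : {b // b ∉ T}) => x b) ⁻¹'
          ((fun (x : B.parts → Ω) (b : {b // b ∉ T}) => x b) '' K) := by
    ext x
    simp only [nbhd, mem_ofPred_eq, mem_iUnion, mem_preimage, mem_image, exists_prop]
    constructor
    · rintro ⟨a, ha, hax⟩
      refine ⟨_, hax, a, ha, funext fun b => ?_⟩
      by_contra hb
      exact b.2 (Finset.mem_filter.2 ⟨Finset.mem_univ _, hb⟩)
    · rintro ⟨T, hT, a, ha, hax⟩
      refine ⟨a, ha, (submeasureDist_le_of_forall_eq hφ fun b hb => ?_).trans_lt hT⟩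
      exact congr_fun hax ⟨b, fun hbT => hb (Finset.le_sup (f := fun b : B.parts => (b : A)) hbT)⟩
  rw [h]
  refine (Set.toFinite _).isClosed_biUnion fun T _ => ?_
  have hc : Continuous fun (x : B.parts → Ω) (b : {b // b ∉ T}) => x b := by fun_prop
  exact (hK.image hc).isClosed.preimage hc

theorem iInf_submeasureDist_lt_iff (hφ : IsSubmeasure φ) {K : Set (B.parts → Ω)}
    (hne : K.Nonempty) (x : B.parts → Ω) (r : ℝ) :
    ⨅ a : K, submeasureDist φ B a x < r ↔ x ∈ nbhd (submeasureDist φ B) K r := by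
  have := hne.to_subtype
  rw [ciInf_lt_iff ⟨0, by rintro _ ⟨a, rfl⟩; exact submeasureDist_nonneg hφ _ _⟩]
  simp [nbhd]

theorem iInf_submeasureDist_nonneg (hφ : IsSubmeasure φ) (K : Set (B.parts → Ω))
    (x : B.parts → Ω) : 0 ≤ ⨅ a : K, submeasureDist φ B a x :=
  Real.iInf_nonneg fun _ => submeasureDist_nonneg hφ _ _

theorem iInf_submeasureDist_le (hφ : IsSubmeasure φ) {K : Set (B.parts → Ω)} {a : B.parts → Ω}
    (ha : a ∈ K) (x : B.parts → Ω) :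
    ⨅ a : K, submeasureDist φ B a x ≤ submeasureDist φ B a x :=
  ciInf_le (f := fun a : K => submeasureDist φ B (a : B.parts → Ω) x)
    ⟨0, by rintro _ ⟨a, rfl⟩; exact submeasureDist_nonneg hφ _ _⟩ ⟨a, ha⟩

theorem isBddMeasurable_iInf_submeasureDist [TopologicalSpace Ω] [T2Space Ω]
    [SecondCountableTopology Ω] [MeasurableSpace Ω] [BorelSpace Ω] (hφ : IsSubmeasure φ)
    {K : Set (B.parts → Ω)} (hK : IsCompact K) (hne : K.Nonempty) :
    IsBddMeasurable fun x => ⨅ a : K, submeasureDist φ B (a : B.parts → Ω) x := by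
  constructor
  · refine measurable_of_Iio fun r => ?_
    convert (isClosed_nbhd_submeasureDist hφ hK r).measurableSet using 1
    ext x
    exact iInf_submeasureDist_lt_iff hφ hne x r
  · obtain ⟨a, ha⟩ := hne
    refine ⟨φ ⊤, fun x => ?_⟩
    rw [abs_of_nonneg (iInf_submeasureDist_nonneg hφ K x)]
    exact (iInf_submeasureDist_le hφ ha x).trans (submeasureDist_le_top hφ _ _)

theorem iInf_submeasureDist_sub_le (hφ : IsSubmeasure φ) {K : Set (B.parts → Ω)}
    (hne : K.Nonempty) (x y : B.parts → Ω) :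
    (⨅ a : K, submeasureDist φ B a x) - ⨅ a : K, submeasureDist φ B a y ≤
      submeasureDist φ B y x := by
  have := hne.to_subtype
  rw [sub_le_comm]
  refine le_ciInf fun a => ?_
  have h1 := iInf_submeasureDist_le hφ a.2 x
  have h2 := submeasureDist_triangle hφ a y x
  linarith

end Distance

/-- If `f ≥ 0` has small variance and vanishes on a set of measure at least `1 / 4`, then its mean
is at most `ε / 2`, and Chebyshev's inequality bounds the measure of `{f ≥ ε}`. -/
theorem measureReal_le_of_integral_sq_le {X : Type*} [MeasurableSpace X] {μ : Measure X}
    [IsProbabilityMeasure μ] {f : X → ℝ} (hf : IsBddMeasurable f) {V ε : ℝ} (hε : 0 < ε)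
    (hV : ∫ x, (f x - ∫ y, f y ∂μ) ^ 2 ∂μ ≤ V) (hVε : V ≤ ε ^ 2 / 16)
    (h0 : 1 / 4 ≤ μ.real {x | f x ≤ 0}) :
    μ.real {x | ε ≤ f x} ≤ 4 * V / ε ^ 2 := by
  set e := ∫ y, f y ∂μ
  have hd : IsBddMeasurable fun x => f x - e :=
    hf.sub ⟨measurable_const, |e|, fun _ => le_rfl⟩
  have hi : Integrable (fun x => (f x - e) ^ 2) μ := by
    simpa only [sq] using (hd.mul hd).integrable
  have cheb (r : ℝ) (S : Set X) (hS : ∀ x ∈ S, r ≤ (f x - e) ^ 2) (hr : 0 ≤ r) :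
      r * μ.real S ≤ V := by
    refine le_trans ?_ ((mul_meas_ge_le_integral_of_nonneg (ae_of_all _ fun x => sq_nonneg _)
      hi r).trans hV)
    exact mul_le_mul_of_nonneg_left (measureReal_mono hS) hr
  have he : e ≤ ε / 2 := by
    by_contra! he
    have h1 := cheb (e ^ 2) {x | f x ≤ 0} (fun x hx => by
      have : f x ≤ 0 := hx
      nlinarith) (sq_nonneg _)
    nlinarith [mul_le_mul_of_nonneg_left h0 (sq_nonneg e)]
  have h2 := cheb ((ε / 2) ^ 2) {x | ε ≤ f x} (fun x hx => by
    have : ε ≤ f x := hx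
    nlinarith) (sq_nonneg _)
  rw [le_div_iff₀ (by positivity)]
  linarith

/-- Concentration from a cover: if every part of `B` lies below at least `k` of the elements
`C 0, …, C (m - 1)` of `φ`-value at most `ξ`, and `m * ξ ^ 2 / k` is small, then the concentration
function of the product space over `B` is at most `ε` at `ε`. -/
theorem concentrationFunction_le_of_cover {A : Type*} [BooleanAlgebra A] {φ : A → ℝ}
    (hφ : IsSubmeasure φ) (B : Finpartition (⊤ : A)) {m k : ℕ} (C : Fin m → A) {ξ ε : ℝ}
    (hε : 0 < ε) (hk : 0 < k) (hC : ∀ i, φ (C i) ≤ ξ)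
    (hcov : ∀ b ∈ B.parts, ∃ s : Finset (Fin m), k ≤ s.card ∧ ∀ i ∈ s, b ≤ C i)
    (h1 : m * ξ ^ 2 / k ≤ ε ^ 2 / 16) (h2 : m * ξ ^ 2 / k ≤ ε ^ 3 / 4) :
    concentrationFunction (submeasureDist φ B (Ω := unitInterval))
      (Measure.pi (fun _ : B.parts => (volume : Measure unitInterval))) ε ≤ ENNReal.ofReal ε := by
  classical
  set μ := Measure.pi (fun _ : B.parts => (volume : Measure unitInterval)) with hμ
  refine tsub_le_iff_tsub_le.1 (le_iInf₂ fun S hS => le_iInf fun hS2 => ?_)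
  -- A neighbourhood of a Borel set need not be Borel, so `S` is replaced by a compact subset.
  obtain ⟨K, hKS, hK, hK4⟩ : ∃ K ⊆ S, IsCompact K ∧ 1 / 4 < μ K :=
    hS.exists_lt_isCompact (lt_of_lt_of_le (by
      rw [one_div, one_div, ENNReal.inv_lt_inv]; norm_num) hS2)
  have hne : K.Nonempty := by
    rw [nonempty_iff_ne_empty]
    rintro rfl
    simp at hK4
  set f : (B.parts → unitInterval) → ℝ := fun x => ⨅ a : K, submeasureDist φ B a x with hf
  have hfm : IsBddMeasurable f := isBddMeasurable_iInf_submeasureDist hφ hK hne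
  have hvar := mul_variance_le_of_cover (fun _ : B.parts => (volume : Measure unitInterval)) hfm
    (fun i => Finset.univ.filter fun b : B.parts => (b : A) ≤ C i) k ?_ (r := ξ) ?_
  · have hmeas := measureReal_le_of_integral_sq_le (μ := μ) hfm (V := m * ξ ^ 2 / k) hε
      (by rw [le_div_iff₀ (by exact_mod_cast hk), mul_comm]; exact hvar) h1 ?_
    · have hle : μ.real {x | ε ≤ f x} ≤ ε := by
        refine hmeas.trans ?_
        rw [div_le_iff₀ (by positivity)]
        linarith
      have hcompl : (nbhd (submeasureDist φ B) K ε)ᶜ = {x | ε ≤ f x} := by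
        ext x
        rw [mem_compl_iff, ← iInf_submeasureDist_lt_iff hφ hne, not_lt]
        rfl
      have hKm := (isClosed_nbhd_submeasureDist hφ hK ε).measurableSet
      have hmono : μ (nbhd (submeasureDist φ B) K ε) ≤ μ (nbhd (submeasureDist φ B) S ε) :=
        measure_mono fun x ⟨a, ha, hax⟩ => ⟨a, hKS ha, hax⟩
      rw [tsub_le_iff_left, ← measure_univ (μ := μ), ← measure_add_measure_compl hKm, hcompl,
        add_comm]
      refine add_le_add ?_ hmono
      rw [← ofReal_measureReal]
      exact ENNReal.ofReal_le_ofReal hle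
    · have hsub : K ⊆ {x | f x ≤ 0} := fun x hx =>
        (iInf_submeasureDist_le hφ hx x).trans (submeasureDist_self hφ x).le
      refine le_trans ?_ (measureReal_mono hsub)
      have := ENNReal.toReal_mono (measure_ne_top μ K) hK4.le
      simpa [Measure.real] using this
  · intro b
    obtain ⟨s, hs, hsb⟩ := hcov b b.2
    refine hs.trans (Finset.card_le_card fun i hi => ?_)
    simpa using hsb i hi
  · intro i x y
    set z := (Finset.univ.filter fun b : B.parts => (b : A) ≤ C i).piecewise y x with hz
    have hxz (b : B.parts) (hb : ¬ (b : A) ≤ C i) : x b = z b :=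
      (Finset.piecewise_eq_of_notMem _ _ _ (by simpa using hb)).symm
    rw [abs_sub_le_iff]
    constructor
    · exact (iInf_submeasureDist_sub_le hφ hne x z).trans
        ((submeasureDist_le_of_forall_eq hφ fun b hb => (hxz b hb).symm).trans (hC i))
    · exact (iInf_submeasureDist_sub_le hφ hne z x).trans
        ((submeasureDist_le_of_forall_eq hφ hxz).trans (hC i))

/-! ### Covers from large covering numbers -/

section Covers

variable {A : Type*} [BooleanAlgebra A]

/-- The common refinement of the partitions `{c, cᶜ}`, for `c ∈ F`. -/
theorem exists_finpartition_le_or_le_compl (F : Finset A) :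
    ∃ P : Finpartition (⊤ : A), ∀ b ∈ P.parts, ∀ c ∈ F, b ≤ c ∨ b ≤ cᶜ := by
  classical
  induction F using Finset.induction_on with
  | empty => exact ⟨⊤, by simp⟩
  | insert c F _ ih =>
    obtain ⟨P, hP⟩ := ih
    obtain ⟨Q, hQ⟩ : ∃ Q : Finpartition (⊤ : A), ∀ b ∈ Q.parts, b = c ∨ b = cᶜ := by
      by_cases hc : c = cᶜ
      · exact ⟨.ofErase {c} (Finset.supIndep_singleton _ _) (by
          rw [Finset.sup_singleton, id, ← sup_compl_eq_top (x := c), ← hc, sup_idem]),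
          by simp +contextual⟩
      · exact ⟨.ofErase {c, cᶜ} ((Finset.supIndep_pair hc).2 disjoint_compl_right) (by simp),
          by simp +contextual⟩
    refine ⟨P ⊓ Q, fun b hb d hd => ?_⟩
    rcases Finset.mem_insert.1 hd with rfl | hd
    · obtain ⟨q, hq, hbq⟩ := (inf_le_right : P ⊓ Q ≤ Q) hb
      rcases hQ q hq with rfl | rfl
      exacts [.inl hbq, .inr hbq]
    · obtain ⟨p, hp, hbp⟩ := (inf_le_left : P ⊓ Q ≤ P) hb
      exact (hP p hp d hd).imp hbp.trans hbp.trans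

/-- A nonzero element that is below or disjoint from each member of `F` lies below a member of the
partition generated by `F`. -/
theorem exists_mem_generatedPartition_ge {F : Finset A} {b : A} (hb : b ≠ ⊥)
    (h : ∀ c ∈ F, b ≤ c ∨ b ≤ cᶜ) : ∃ a ∈ generatedPartition F, b ≤ a := by
  classical
  have hle : b ≤ (F.filter (b ≤ ·)).inf id ⊓ (F \ F.filter (b ≤ ·)).inf (fun c => cᶜ) := by
    refine le_inf (Finset.le_inf fun c hc => (Finset.mem_filter.1 hc).2)
      (Finset.le_inf fun c hc => ?_)
    simp only [Finset.mem_sdiff, Finset.mem_filter, not_and] at hc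
    exact (h c hc.1).resolve_left (hc.2 hc.1)
  refine ⟨_, ⟨⟨F.filter (b ≤ ·), Finset.filter_subset _ _, ?_⟩, ?_⟩, hle⟩
  · congr!
  · exact fun h0 => hb (le_bot_iff.1 (h0 ▸ hle))

theorem exists_cover_of_lt_coveringNumber {𝓑 : Set A} {M : ℝ≥0∞} (h : M < coveringNumber 𝓑) :
    ∃ (m : ℕ) (C : Fin m → A) (k : ℕ), 1 ≤ m ∧ (∀ i, C i ∈ 𝓑) ∧ M < k / m ∧
      ∃ P : Finpartition (⊤ : A), ∀ b ∈ P.parts,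
        ∃ s : Finset (Fin m), k ≤ s.card ∧ ∀ i ∈ s, b ≤ C i := by
  classical
  simp only [coveringNumber, lt_iSup_iff] at h
  obtain ⟨m, hm, C, hC, h⟩ := h
  simp only [coveringMultiplicity, ENat.toENNReal_iSup, ENNReal.iSup_div, lt_iSup_iff] at h
  obtain ⟨k, hk, h⟩ := h
  obtain ⟨P, hP⟩ := exists_finpartition_le_or_le_compl (Finset.univ.image C)
  refine ⟨m, C, k, hm, hC, by simpa using h, P, fun b hb => ?_⟩
  obtain ⟨a, ha, hba⟩ := exists_mem_generatedPartition_ge (P.ne_bot hb) (hP b hb)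
  refine ⟨_, hk a ha, fun i hi => ?_⟩
  exact hba.trans (Finset.mem_filter.1 hi).2

/-- For hyperbolic and parabolic submeasures, `h_φ ξ / ξ` takes arbitrarily large values. In the
hyperbolic case it is at least a positive constant times `ξ⁻²` for small `ξ`; in the parabolic case
its limit superior at `0` is infinite because `φ` is not elliptic. -/
theorem exists_lt_hFun_div {φ : A → ℝ} (hφ : IsHyperbolic φ ∨ IsParabolic φ) {M : ℝ≥0∞}
    (hM : M ≠ ⊤) : ∃ ξ : ℝ, 0 < ξ ∧ M < hFun φ ξ / ENNReal.ofReal ξ := by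
  rcases hφ with ⟨-, -, h⟩ | ⟨hs, hd, he, -⟩
  -- If `h_φ ξ ≤ M ξ` for all `ξ`, then `1 ≤ N ξ h_φ ξ ≤ N M ξ²` for small `ξ`, which is absurd.
  · by_contra! hle
    obtain ⟨N, hN, hNtop⟩ := exists_between h
    have hev := (eventually_lt_of_limsup_lt hN).and self_mem_nhdsWithin
    have hlim : Tendsto (fun ξ : ℝ => N * ENNReal.ofReal ξ * (M * ENNReal.ofReal ξ)) (𝓝[>] 0)
        (𝓝 (N * ENNReal.ofReal 0 * (M * ENNReal.ofReal 0))) := by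
      have h0 : Tendsto (fun ξ : ℝ => ENNReal.ofReal ξ) (𝓝[>] 0) (𝓝 (ENNReal.ofReal 0)) :=
        (ENNReal.continuous_ofReal.tendsto 0).mono_left nhdsWithin_le_nhds
      refine ENNReal.Tendsto.mul (ENNReal.Tendsto.const_mul h0 (.inr hNtop.ne)) (.inr ?_)
        (ENNReal.Tendsto.const_mul h0 (.inr hM)) (.inr ?_) <;> simp
    simp only [ENNReal.ofReal_zero, mul_zero] at hlim
    obtain ⟨ξ, ⟨h1, hξ⟩, h2⟩ := (hev.and (hlim.eventually_lt_const zero_lt_one)).exists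
    have hξ0 : ENNReal.ofReal ξ ≠ 0 := by simpa using hξ
    have h3 : hFun φ ξ ≤ M * ENNReal.ofReal ξ :=
      (ENNReal.div_le_iff hξ0 ENNReal.ofReal_ne_top).1 (hle ξ hξ)
    have h4 : 1 / hFun φ ξ < N * ENNReal.ofReal ξ :=
      (ENNReal.div_lt_iff (.inl hξ0) (.inl ENNReal.ofReal_ne_top)).1 h1
    have htop : hFun φ ξ ≠ ⊤ := (h3.trans_lt (ENNReal.mul_lt_top hM.lt_top
      ENNReal.ofReal_lt_top)).ne
    have h5 : 1 ≤ N * ENNReal.ofReal ξ * hFun φ ξ :=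
      (ENNReal.div_le_iff_le_mul
      (.inr (ENNReal.mul_lt_top hNtop ENNReal.ofReal_lt_top).ne) (.inl htop)).1 h4.le
    exact absurd (h5.trans (mul_le_mul_right h3 _)) (not_le.2 h2)
  · have hlim : limsup (fun ξ : ℝ => hFun φ ξ / ENNReal.ofReal ξ) (𝓝[>] (0 : ℝ)) = ⊤ :=
      not_lt_top_iff.1 fun h => he ⟨hs, hd, h⟩
    obtain ⟨ξ, h, hξ⟩ := ((frequently_lt_of_lt_limsup (by isBoundedDefault)
      (hlim ▸ hM.lt_top)).and_eventually self_mem_nhdsWithin).exists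
    exact ⟨ξ, hξ, h⟩

end Covers

theorem theorem5p5 {A : Type*} [BooleanAlgebra A] (φ : A → ℝ)
    (hφ : IsHyperbolic φ ∨ IsParabolic φ) :
    HasCoveringConcentration φ := by
  intro ε hε
  have hs : IsSubmeasure φ := hφ.elim (·.1) (·.1)
  obtain ⟨δ, hδ, h1, h2⟩ : ∃ δ : ℝ, 0 < δ ∧ δ ≤ ε ^ 2 / 16 ∧ δ ≤ ε ^ 3 / 4 :=
    ⟨min (ε ^ 2 / 16) (ε ^ 3 / 4), by positivity, min_le_left _ _, min_le_right _ _⟩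
  obtain ⟨ξ, hξ, h⟩ := exists_lt_hFun_div hφ (M := ENNReal.ofReal δ⁻¹) ENNReal.ofReal_ne_top
  rw [hFun, ENNReal.lt_div_iff_mul_lt (by simp [hξ]) (by simp),
    ENNReal.lt_div_iff_mul_lt (by simp [hξ]) (by simp), ← ENNReal.ofReal_mul (by positivity),
    ← ENNReal.ofReal_mul (by positivity)] at h
  obtain ⟨m, C, k, hm, hC, hk, P, hP⟩ := exists_cover_of_lt_coveringNumber h
  have hm0 : (0 : ℝ) < m := by exact_mod_cast hm
  have hk' : δ⁻¹ * ξ * ξ < k / m := by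
    rw [← ENNReal.ofReal_natCast k, ← ENNReal.ofReal_natCast m, ← ENNReal.ofReal_div_of_pos hm0]
      at hk
    exact (ENNReal.ofReal_lt_ofReal_iff_of_nonneg (by positivity)).1 hk
  have hk0 : (0 : ℝ) < k := by
    have : 0 < (k : ℝ) / m := lt_trans (by positivity) hk'
    exact (div_pos_iff_of_pos_right hm0).1 this
  have hle : m * ξ ^ 2 / k ≤ δ := by
    rw [lt_div_iff₀ hm0] at hk'
    rw [div_le_iff₀ hk0]
    have := mul_le_mul_of_nonneg_left hk'.le hδ.le
    field_simp at this
    linarith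
  refine ⟨P, iSup₂_le fun B hB => concentrationFunction_le_of_cover hs B C hε
    (by exact_mod_cast hk0) hC (fun b hb => ?_) (hle.trans h1) (hle.trans h2)⟩
  obtain ⟨p, hp, hbp⟩ := hB hb
  obtain ⟨s, hsk, hs⟩ := hP p hp
  exact ⟨s, hsk, fun i hi => hbp.trans (hs i hi)⟩
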